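/- Let $U(n)$ be the group of unitary $n\times n$ complex matrices, let $\|\cdot\|_\infty$ be the spectral (operator) norm, and let $$d_\infty(U,V)=\inf\Big\{\int_0^1\|\dot\alpha(s)\|_\infty\,ds\;:\;\alpha:[0,1]\to U(n)\text{ piecewise smooth},\ \alpha(0)=U,\ \alpha(1)=V\Big\}.$$ By a geodesic of $U(n)$ we mean a curve $s\mapsto We^{sZ}$ with $W\in U(n)$ and $Z$ anti-Hermitian; a geodesic $\beta:[0,1]\to U(n)$ is minimal if its length $\int_0^1\|\dot\beta(s)\|_\infty\,ds$ equals $d_\infty(\beta(0),\beta(1))$. A set $S\subseteq U(n)$ is called geodesically convex if any two points $W_0,W_1\in S$ are joined by exactly one minimal geodesic $\beta:[0,1]\to U(n)$, $\beta(0)=W_0$, $\beta(1)=W_1$, and $\beta(s)\in S$ for all $s\in[0,1]$. Let $U,V\in U(n)$ satisfy $d_\infty(U,V)<\pi/2$, and let $t\in(0,1)$. Then the set $$\mathcal M_t(U,V)=\{W\in U(n): d_\infty(U,W)=t\,d_\infty(U,V)\ \text{ and }\ d_\infty(W,V)=(1-t)\,d_\infty(U,V)\}$$ is geodesically convex. 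-/

import Mathlib

namespace UnitaryFinsler

open scoped Matrix.Norms.L2Operator ContDiff
open Set

/-- A curve `α : [0,1] → U(n)` is piecewise smooth if `[0,1]` has a finite subdivision
`0 = τ 0 ≤ τ 1 ≤ … ≤ τ k = 1` such that `α` is `C^∞` (up to the end points) on each closed
subinterval. Values of `α` outside `[0,1]` play no role. Smoothness into `U(n)` is smoothness
into the space of all matrices, as `U(n)` is an embedded submanifold. -/
def IsPiecewiseSmooth {n : ℕ} (α : ℝ → Matrix.unitaryGroup (Fin n) ℂ) : Prop :=
  ∃ (k : ℕ) (τ : ℕ → ℝ), Monotone τ ∧ τ 0 = 0 ∧ τ k = 1 ∧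
    ∀ i < k, ContDiffOn ℝ ∞ (fun s => (α s : Matrix (Fin n) (Fin n) ℂ)) (Icc (τ i) (τ (i + 1)))

/-- The length `∫₀¹ ‖α'(s)‖ ds` of a curve in `U(n)`, where `‖·‖` is the spectral norm
(the norm of the bi-invariant Finsler metric `‖X‖_U = ‖U* X‖ = ‖X‖`). -/
noncomputable def curveLength {n : ℕ} (α : ℝ → Matrix.unitaryGroup (Fin n) ℂ) : ℝ :=
  ∫ s in (0 : ℝ)..1, ‖deriv (fun r => (α r : Matrix (Fin n) (Fin n) ℂ)) s‖

/-- The rectifiable distance `d_∞`: the infimum of the lengths of the piecewise smooth curves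
in `U(n)` with the given end points. -/
noncomputable def dInf {n : ℕ} (U V : Matrix.unitaryGroup (Fin n) ℂ) : ℝ :=
  sInf {L : ℝ | ∃ α : ℝ → Matrix.unitaryGroup (Fin n) ℂ,
    IsPiecewiseSmooth α ∧ α 0 = U ∧ α 1 = V ∧ curveLength α = L}

/-- The geodesics of `U(n)` are the curves `s ↦ U e^{sZ}` with `Z` anti-Hermitian. -/
def IsGeodesic {n : ℕ} (β : ℝ → Matrix.unitaryGroup (Fin n) ℂ) : Prop :=
  ∃ (U : Matrix.unitaryGroup (Fin n) ℂ) (Z : Matrix (Fin n) (Fin n) ℂ),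
    Z.conjTranspose = -Z ∧
    ∀ s : ℝ, (β s : Matrix (Fin n) (Fin n) ℂ) =
      (U : Matrix (Fin n) (Fin n) ℂ) * NormedSpace.exp (s • Z)

/-- `β`, on `[0,1]`, is a geodesic from `W₀` to `W₁` whose length is the distance of its end
points. -/
def IsMinimalGeodesic {n : ℕ} (W₀ W₁ : Matrix.unitaryGroup (Fin n) ℂ)
    (β : ℝ → Matrix.unitaryGroup (Fin n) ℂ) : Prop :=
  IsGeodesic β ∧ β 0 = W₀ ∧ β 1 = W₁ ∧ curveLength β = dInf W₀ W₁

/-- A set is geodesically convex if any two of its points are joined by exactly one minimal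
geodesic, and this geodesic stays in the set. -/
def GeodesicallyConvex {n : ℕ} (S : Set (Matrix.unitaryGroup (Fin n) ℂ)) : Prop :=
  ∀ W₀ ∈ S, ∀ W₁ ∈ S,
    (∃! β : ℝ → Matrix.unitaryGroup (Fin n) ℂ, IsMinimalGeodesic W₀ W₁ β) ∧
    ∀ β : ℝ → Matrix.unitaryGroup (Fin n) ℂ, IsMinimalGeodesic W₀ W₁ β →
      ∀ s ∈ Icc (0 : ℝ) 1, β s ∈ S

/-- The set `M_t(U,V)` of intermediate points. -/
def intermediatePoints {n : ℕ} (t : ℝ) (U V : Matrix.unitaryGroup (Fin n) ℂ) :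
    Set (Matrix.unitaryGroup (Fin n) ℂ) :=
  {W | dInf U W = t * dInf U V ∧ dInf W V = (1 - t) * dInf U V}

end UnitaryFinsler

/-! By the triangle inequality `intermediatePoints t U V` is the intersection of two closed balls
about `U` and `V`, of radii below `π / 2` that add up to `dInf U V`. So it suffices that such balls
are convex and that their points are joined by unique minimal geodesics.

Distances are read off from vectors. A curve `α` in `U(n)` moves a unit vector `v` along the sphere
at speed at most `‖α'‖`, so the angle between `U v` and `V v` is at most `dInf U V`. For `V = U *
e^{iX}` with `‖X‖ ≤ π`, an extremal eigenvector of `X` attains `‖X‖` (`dInf_mul_expUnitary`).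

Ball convexity is a midpoint argument (`dInf_midpoint_le`). If `‖X‖ ≤ r < π / 2`, the numerical
range of `e^{iX}` lies in the sector of half-angle `r`, a convex cone. If `e^{iX} e^{iY}` and
`e^{iX} e^{-iY}` both have numerical range there, pairing their sum with an extremal eigenvector of
`X` gives a positive multiple of `e^{iθ}`, `|θ| = ‖X‖`, so `‖X‖ ≤ r`. -/

namespace UnitaryFinsler

open scoped Matrix.Norms.L2Operator ContDiff
open Set
open selfAdjoint (expUnitary)

variable {n : ℕ}

/-! ### Matrices acting on vectors, eigenvectors and logarithms -/

/-- The action of a matrix on the Hermitian space `ℂⁿ`. -/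
noncomputable abbrev action (A : Matrix (Fin n) (Fin n) ℂ) :
    EuclideanSpace ℂ (Fin n) →L[ℂ] EuclideanSpace ℂ (Fin n) :=
  Matrix.toEuclideanCLM (n := Fin n) (𝕜 := ℂ) A

lemma action_mul_apply (A B : Matrix (Fin n) (Fin n) ℂ) (v : EuclideanSpace ℂ (Fin n)) :
    action (A * B) v = action A (action B v) := by
  rw [action, map_mul]
  rfl

lemma action_smul_apply (c : ℂ) (A : Matrix (Fin n) (Fin n) ℂ) (v : EuclideanSpace ℂ (Fin n)) :
    action (c • A) v = c • action A v := by
  rw [action, map_smul]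
  rfl

lemma inner_action_star (A : Matrix (Fin n) (Fin n) ℂ) (v w : EuclideanSpace ℂ (Fin n)) :
    inner ℂ (action (star A) v) w = inner ℂ v (action A w) := by
  rw [action, map_star, ContinuousLinearMap.star_eq_adjoint,
    ContinuousLinearMap.adjoint_inner_left]

lemma norm_action_unitary (W : Matrix.unitaryGroup (Fin n) ℂ) (v : EuclideanSpace ℂ (Fin n)) :
    ‖action (W : Matrix (Fin n) (Fin n) ℂ) v‖ = ‖v‖ := by
  have h : inner ℂ (action (W : Matrix (Fin n) (Fin n) ℂ) v) (action W v) = inner ℂ v v := by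
    have := inner_action_star (star (W : Matrix (Fin n) (Fin n) ℂ)) v
      (action (W : Matrix (Fin n) (Fin n) ℂ) v)
    rw [star_star, ← action_mul_apply, Unitary.coe_star_mul_self] at this
    rw [this, action, map_one]
    rfl
  rw [inner_self_eq_norm_sq_to_K, inner_self_eq_norm_sq_to_K] at h
  exact (sq_eq_sq₀ (norm_nonneg _) (norm_nonneg _)).1 (by exact_mod_cast h)

/-- Evaluation of matrices at a vector, as a continuous real-linear map. -/
noncomputable def evalAt (v : EuclideanSpace ℂ (Fin n)) :
    Matrix (Fin n) (Fin n) ℂ →L[ℂ] EuclideanSpace ℂ (Fin n) :=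
  LinearMap.toContinuousLinearMap
    { toFun := fun A => action A v
      map_add' := fun A B => by simp [action]
      map_smul' := fun c A => by simp [action] }

lemma evalAt_apply (v : EuclideanSpace ℂ (Fin n)) (A : Matrix (Fin n) (Fin n) ℂ) :
    evalAt v A = action A v := rfl

lemma action_exp_of_eigenvector {A : Matrix (Fin n) (Fin n) ℂ} {v : EuclideanSpace ℂ (Fin n)}
    {c : ℂ} (h : action A v = c • v) : action (NormedSpace.exp A) v = Complex.exp c • v := by
  have hpow (k : ℕ) : action (A ^ k) v = c ^ k • v := by
    induction k with
    | zero => simp [action]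
    | succ k ih =>
      rw [pow_succ', action_mul_apply, ih, map_smul, h, smul_smul, pow_succ]
  have h1 := (NormedSpace.exp_series_hasSum_exp' (𝕂 := ℂ) A).mapL (evalAt v)
  have h2 := (NormedSpace.exp_series_hasSum_exp' (𝕂 := ℂ) c).smul_const v
  rw [← Complex.exp_eq_exp_ℂ] at h2
  refine h1.unique ?_
  convert h2 using 2 with k
  rw [evalAt_apply, action_smul_apply, hpow, smul_assoc]

lemma action_expUnitary_of_eigenvector {X : selfAdjoint (Matrix (Fin n) (Fin n) ℂ)}
    {v : EuclideanSpace ℂ (Fin n)} {θ : ℝ} (h : action (X : Matrix (Fin n) (Fin n) ℂ) v = (θ : ℂ) • v)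
    (s : ℝ) : action (expUnitary (s • X) : Matrix (Fin n) (Fin n) ℂ) v =
      Complex.exp ((s * θ : ℝ) * Complex.I) • v := by
  rw [selfAdjoint.expUnitary_coe]
  apply action_exp_of_eigenvector
  have : (Complex.I • ((s • X : selfAdjoint _) : Matrix (Fin n) (Fin n) ℂ)) =
      ((s : ℂ) * Complex.I) • (X : Matrix (Fin n) (Fin n) ℂ) := by
    rw [mul_comm, mul_smul]; rfl
  rw [this, action_smul_apply, h, smul_smul]
  congr 1
  push_cast
  ring

lemma exists_extremal_eigenvector [NeZero n] (X : selfAdjoint (Matrix (Fin n) (Fin n) ℂ)) :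
    ∃ (v : EuclideanSpace ℂ (Fin n)) (θ : ℝ), ‖v‖ = 1 ∧ |θ| = ‖X‖ ∧
      action (X : Matrix (Fin n) (Fin n) ℂ) v = (θ : ℂ) • v := by
  have key : ∃ θ : ℝ, |θ| = ‖X‖ ∧ θ ∈ spectrum ℝ (X : Matrix (Fin n) (Fin n) ℂ) := by
    rcases CStarAlgebra.norm_or_neg_norm_mem_spectrum (a := (X : Matrix (Fin n) (Fin n) ℂ)) X.2
      with h | h
    · exact ⟨_, abs_norm _, h⟩
    · exact ⟨_, by rw [abs_neg, abs_norm]; rfl, h⟩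
  obtain ⟨θ, hθ, hs⟩ := key
  have hX : (X : Matrix (Fin n) (Fin n) ℂ).IsHermitian := X.2
  rw [hX.spectrum_real_eq_range_eigenvalues] at hs
  obtain ⟨i, rfl⟩ := hs
  refine ⟨hX.eigenvectorBasis i, hX.eigenvalues i, hX.eigenvectorBasis.orthonormal.1 i, hθ, ?_⟩
  ext j
  simpa using congrFun (hX.mulVec_eigenvectorBasis i) j

/-- Expanding `v` in an eigenbasis of `X` exhibits the numerical range of `e^{isX}` as convex
combinations of its eigenvalues. -/
lemma exists_spectral_weights (X : selfAdjoint (Matrix (Fin n) (Fin n) ℂ))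
    (v : EuclideanSpace ℂ (Fin n)) (hv : ‖v‖ = 1) :
    ∃ p θ : Fin n → ℝ, (∀ j, 0 ≤ p j) ∧ ∑ j, p j = 1 ∧ (∀ j, |θ j| ≤ ‖X‖) ∧
      ∀ s : ℝ, inner ℂ v (action (expUnitary (s • X) : Matrix (Fin n) (Fin n) ℂ) v) =
        ∑ j, (p j : ℂ) * Complex.exp ((s * θ j : ℝ) * Complex.I) := by
  have hX : (X : Matrix (Fin n) (Fin n) ℂ).IsHermitian := X.2
  set b := hX.eigenvectorBasis
  have hb (j : Fin n) : action (X : Matrix (Fin n) (Fin n) ℂ) (b j) =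
      (hX.eigenvalues j : ℂ) • b j := by
    ext i
    simpa using congrFun (hX.mulVec_eigenvectorBasis j) i
  refine ⟨fun j => ‖inner ℂ (b j) v‖ ^ 2, hX.eigenvalues, fun j => by positivity, ?_, ?_, ?_⟩
  · rw [b.sum_sq_norm_inner_right, hv, one_pow]
  · intro j
    have := (action (X : Matrix (Fin n) (Fin n) ℂ)).le_opNorm (b j)
    rw [hb, norm_smul, b.orthonormal.1 j, mul_one, mul_one, Complex.norm_real] at this
    exact this
  · intro s
    conv_lhs => enter [3]; rw [← b.sum_repr v]
    simp_rw [map_sum, inner_sum, map_smul, action_expUnitary_of_eigenvector (hb _), inner_smul_right,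
      b.repr_apply_apply]
    refine Finset.sum_congr rfl fun j _ => ?_
    rw [← inner_conj_symm v (b j)]
    push_cast
    rw [← Complex.mul_conj']
    ring

lemma exists_eq_mul_expUnitary (U V : Matrix.unitaryGroup (Fin n) ℂ) :
    ∃ X : selfAdjoint (Matrix (Fin n) (Fin n) ℂ), ‖X‖ ≤ Real.pi ∧ V = U * expUnitary X := by
  refine ⟨Unitary.argSelfAdjoint (U⁻¹ * V), Unitary.norm_argSelfAdjoint_le_pi _, ?_⟩
  rw [← inv_mul_eq_iff_eq_mul]
  generalize U⁻¹ * V = u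
  apply Subtype.ext
  -- The spectrum is finite, so even `arg`, discontinuous at `-1`, is admissible in the functional
  -- calculus.
  have hc (f : ℂ → ℂ) : ContinuousOn f (spectrum ℂ (u : Matrix (Fin n) (Fin n) ℂ)) :=
    (Matrix.finite_spectrum (u : Matrix (Fin n) (Fin n) ℂ)).continuousOn f
  rw [selfAdjoint.expUnitary_coe, Unitary.argSelfAdjoint_coe,
    ← CFC.exp_eq_normedSpace_exp (𝕜 := ℂ), ← cfc_smul (R := ℂ) _ _ _ (hc _),
    ← cfc_comp' (R := ℂ) _ _ _ (by fun_prop) (hc _)]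
  conv_lhs => rw [← cfc_id' ℂ (u : Matrix (Fin n) (Fin n) ℂ)]
  refine cfc_congr fun y hy => ?_
  have hy₁ : ‖y‖ = 1 := spectrum.norm_eq_one_of_unitary u.2 hy
  have h0 : y ≠ 0 := by rintro rfl; simp at hy₁
  have : Complex.I * y.arg = Complex.log y :=
    Complex.ext (by simp [Complex.log_re, hy₁]) (by simp [Complex.log_im])
  simpa [← Complex.exp_eq_exp_ℂ, this] using (Complex.exp_log h0).symm

/-! ### Curves on the unit sphere -/

section Sphere

variable {F : Type*} [NormedAddCommGroup F] [InnerProductSpace ℝ F]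

/-- Only the component of `w` orthogonal to `y` pairs with `d`; then Cauchy–Schwarz. -/
lemma abs_inner_le_of_inner_eq_zero {w y d : F} (hw : ‖w‖ = 1) (hy : ‖y‖ = 1)
    (hd : inner ℝ y d = 0) : |inner ℝ w d| ≤ √(1 - inner ℝ w y ^ 2) * ‖d‖ := by
  have h1 : inner ℝ w d = inner ℝ (w - (inner ℝ w y : ℝ) • y) d := by
    rw [inner_sub_left, real_inner_smul_left, hd, mul_zero, sub_zero]
  have h2 : ‖w - (inner ℝ w y : ℝ) • y‖ = √(1 - inner ℝ w y ^ 2) := by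
    rw [← Real.sqrt_sq (norm_nonneg (w - _)), norm_sub_sq_real, real_inner_smul_right, norm_smul,
      hw, hy, mul_one, Real.norm_eq_abs, sq_abs]
    congr 1
    ring
  rw [h1, ← h2]
  exact abs_real_inner_le_norm _ _

lemma inner_deriv_eq_zero_of_norm_eq_one {γ : ℝ → F} {d : F} {a b s : ℝ} (hs : s ∈ Ioo a b)
    (hγ : ∀ r ∈ Icc a b, ‖γ r‖ = 1) (hd : HasDerivAt γ d s) : inner ℝ (γ s) d = 0 := by
  have h1 := hd.norm_sq
  have h2 : (‖γ ·‖ ^ 2) =ᶠ[nhds s] fun _ => (1 : ℝ) := by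
    filter_upwards [Icc_mem_nhds hs.1 hs.2] with r hr
    rw [hγ r hr, one_pow]
  have h3 := h1.unique ((hasDerivAt_const s (1 : ℝ)).congr_of_eventuallyEq h2)
  linarith

/-- Damping the inner product by `κ < 1` keeps `arccos` differentiable. -/
lemma arccos_mul_inner_sub_le_integral {γ γ' : ℝ → F} {φ : ℝ → ℝ} {w : F} {a b κ : ℝ} (hab : a ≤ b)
    (hκ : κ ∈ Ioo (0 : ℝ) 1) (hw : ‖w‖ = 1) (hγ : ∀ s ∈ Icc a b, ‖γ s‖ = 1)
    (hcont : ContinuousOn γ (Icc a b)) (hderiv : ∀ s ∈ Ioo a b, HasDerivAt γ (γ' s) s)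
    (hφ : MeasureTheory.IntegrableOn φ (Icc a b)) (hle : ∀ s ∈ Ioo a b, ‖γ' s‖ ≤ φ s) :
    Real.arccos (κ * inner ℝ w (γ b)) - Real.arccos (κ * inner ℝ w (γ a)) ≤ ∫ s in a..b, φ s := by
  obtain ⟨hκ0, hκ1⟩ := hκ
  refine intervalIntegral.sub_le_integral_of_hasDeriv_right_of_le
    (g := fun s => Real.arccos (κ * inner ℝ w (γ s)))
    (g' := fun s => -(1 / √(1 - (κ * inner ℝ w (γ s)) ^ 2)) * (κ * inner ℝ w (γ' s)))
    hab ?_ ?_ hφ ?_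
  · exact Real.continuous_arccos.comp_continuousOn
      (continuousOn_const.mul (continuousOn_const.inner hcont))
  all_goals
    intro s hs
    have hy := hγ s (Ioo_subset_Icc_self hs)
    have hf : |inner ℝ w (γ s)| ≤ 1 := by
      simpa [hw, hy] using abs_real_inner_le_norm w (γ s)
    have hf2 : inner ℝ w (γ s) ^ 2 ≤ 1 := by
      rw [← sq_abs]; exact pow_le_one₀ (abs_nonneg _) hf
    have hlt : (κ * inner ℝ w (γ s)) ^ 2 < 1 := by
      rw [mul_pow]
      have : κ ^ 2 < 1 := pow_lt_one₀ hκ0.le hκ1 two_ne_zero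
      nlinarith [sq_nonneg (inner ℝ w (γ s) : ℝ)]
  · have h1 : HasDerivAt (fun r => κ * inner ℝ w (γ r)) (κ * inner ℝ w (γ' s)) s := by
      have := ((hasDerivAt_const s w).inner ℝ (hderiv s hs)).const_mul κ
      simpa using this
    have h2 := Real.hasDerivAt_arccos (x := κ * inner ℝ w (γ s))
      (by intro h; rw [h] at hlt; norm_num at hlt) (by intro h; rw [h] at hlt; norm_num at hlt)
    exact (h2.comp s h1).hasDerivWithinAt
  · have hpos : 0 < √(1 - (κ * inner ℝ w (γ s)) ^ 2) := Real.sqrt_pos.2 (by linarith)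
    have horth := inner_deriv_eq_zero_of_norm_eq_one hs hγ (hderiv s hs)
    have h1 := abs_inner_le_of_inner_eq_zero hw hy horth
    have h2 : κ * √(1 - inner ℝ w (γ s) ^ 2) ≤ √(1 - (κ * inner ℝ w (γ s)) ^ 2) := by
      refine Real.le_sqrt_of_sq_le ?_
      rw [mul_pow, mul_pow, Real.sq_sqrt (by linarith)]
      nlinarith
    refine le_trans ?_ (hle s hs)
    have h3 : -(1 / √(1 - (κ * inner ℝ w (γ s)) ^ 2)) * (κ * inner ℝ w (γ' s)) =
        κ * -inner ℝ w (γ' s) / √(1 - (κ * inner ℝ w (γ s)) ^ 2) := by ring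
    rw [h3, div_le_iff₀ hpos]
    calc κ * -inner ℝ w (γ' s) ≤ κ * (√(1 - inner ℝ w (γ s) ^ 2) * ‖γ' s‖) := by
          gcongr; exact (neg_le_abs _).trans h1
      _ = κ * √(1 - inner ℝ w (γ s) ^ 2) * ‖γ' s‖ := by ring
      _ ≤ √(1 - (κ * inner ℝ w (γ s)) ^ 2) * ‖γ' s‖ := by gcongr
      _ = _ := mul_comm _ _

end Sphere

/-! ### Length of a unitary curve against the displacement of a vector -/

lemma integrableOn_norm_deriv {α : ℝ → Matrix (Fin n) (Fin n) ℂ} {a b : ℝ} (hab : a ≤ b)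
    (hα : ContDiffOn ℝ ∞ α (Icc a b)) :
    MeasureTheory.IntegrableOn (fun s => ‖deriv α s‖) (Icc a b) := by
  rcases hab.eq_or_lt with rfl | hlt
  · simp
  · have h1 : ContinuousOn (fun s => ‖derivWithin α (Icc a b) s‖) (Icc a b) :=
      (hα.continuousOn_derivWithin (uniqueDiffOn_Icc hlt) (by simp)).norm
    -- At the break points `deriv` may differ from the one-sided derivative; these form a null set.
    rw [integrableOn_Icc_iff_integrableOn_Ioo]
    refine ((h1.integrableOn_Icc).mono_set Ioo_subset_Icc_self).congr_fun (fun s hs => ?_)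
      measurableSet_Ioo
    simp only [derivWithin_of_mem_nhds (Icc_mem_nhds hs.1 hs.2)]

/-- The angle by which a unit vector is moved is at most the length of the curve moving it. -/
theorem arccos_inner_le_curveLength {α : ℝ → Matrix.unitaryGroup (Fin n) ℂ}
    (hα : IsPiecewiseSmooth α) {v : EuclideanSpace ℂ (Fin n)} (hv : ‖v‖ = 1) :
    Real.arccos (inner ℝ (action (α 0 : Matrix (Fin n) (Fin n) ℂ) v)
      (action (α 1 : Matrix (Fin n) (Fin n) ℂ) v)) ≤ curveLength α := by
  obtain ⟨k, τ, hτ, h0, h1, hsm⟩ := hα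
  set γ : ℝ → EuclideanSpace ℂ (Fin n) := fun s => action (α s : Matrix (Fin n) (Fin n) ℂ) v
  have hγ (s : ℝ) : ‖γ s‖ = 1 := (norm_action_unitary _ _).trans hv
  set A : ℝ → Matrix (Fin n) (Fin n) ℂ := fun s => α s
  set e := (evalAt v).restrictScalars ℝ
  have hκ : ∀ κ ∈ Ioo (0 : ℝ) 1, Real.arccos (κ * inner ℝ (γ 0) (γ 1)) -
      Real.arccos (κ * inner ℝ (γ 0) (γ 0)) ≤ curveLength α := by
    intro κ hκ
    have hint (i : ℕ) (hi : i < k) :=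
      integrableOn_norm_deriv (hτ i.le_succ) (hsm i hi)
    have hsum := intervalIntegral.sum_integral_adjacent_intervals (a := τ) (n := k)
      (μ := MeasureTheory.volume) (f := fun s => ‖deriv A s‖)
      (fun i hi => (intervalIntegrable_iff_integrableOn_Icc_of_le (hτ i.le_succ)).2 (hint i hi))
    rw [h0, h1] at hsum
    rw [curveLength, ← hsum, ← h0, ← h1,
      ← Finset.sum_range_sub (fun i => Real.arccos (κ * inner ℝ (γ (τ 0)) (γ (τ i)))) k]
    refine Finset.sum_le_sum fun i hi => ?_
    have hi := Finset.mem_range.1 hi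
    refine arccos_mul_inner_sub_le_integral (γ' := fun s => e (deriv A s)) (hτ i.le_succ) hκ
      (hγ _) (fun s _ => hγ s) (e.continuous.comp_continuousOn (hsm i hi).continuousOn) ?_
      (hint i hi) ?_
    · intro s hs
      have hd : DifferentiableAt ℝ A s :=
        ((hsm i hi).contDiffAt (Icc_mem_nhds hs.1 hs.2)).differentiableAt (by simp)
      exact e.hasFDerivAt.comp_hasDerivAt s hd.hasDerivAt
    · intro s _
      have := (action (deriv A s)).le_opNorm v
      rwa [hv, mul_one] at this
  -- The damping is removed by letting `κ` tend to `1` from below.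
  have hlim : Filter.Tendsto (fun κ : ℝ => Real.arccos (κ * inner ℝ (γ 0) (γ 1)) -
      Real.arccos (κ * inner ℝ (γ 0) (γ 0))) (nhdsWithin 1 (Iio 1))
      (nhds (Real.arccos (1 * inner ℝ (γ 0) (γ 1)) - Real.arccos (1 * inner ℝ (γ 0) (γ 0)))) := by
    refine (Continuous.tendsto ?_ 1).mono_left nhdsWithin_le_nhds
    exact (Real.continuous_arccos.comp (by fun_prop)).sub
      (Real.continuous_arccos.comp (by fun_prop))
  rw [one_mul, one_mul, real_inner_self_eq_norm_sq, hγ, one_pow, Real.arccos_one, sub_zero] at hlim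
  refine le_of_tendsto hlim ?_
  filter_upwards [Ioo_mem_nhdsLT one_pos] with κ h
  simpa [real_inner_self_eq_norm_sq, hγ] using hκ κ h

/-! ### Geodesics and their lengths -/

/-- The geodesic `s ↦ W e^{isX}`. -/
noncomputable def geodesic (W : Matrix.unitaryGroup (Fin n) ℂ)
    (X : selfAdjoint (Matrix (Fin n) (Fin n) ℂ)) (s : ℝ) : Matrix.unitaryGroup (Fin n) ℂ :=
  W * expUnitary (s • X)

section Geodesic

variable (W : Matrix.unitaryGroup (Fin n) ℂ) (X : selfAdjoint (Matrix (Fin n) (Fin n) ℂ))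

lemma coe_geodesic (s : ℝ) : (geodesic W X s : Matrix (Fin n) (Fin n) ℂ) =
    W * NormedSpace.exp (s • (Complex.I • (X : Matrix (Fin n) (Fin n) ℂ))) := by
  rw [geodesic, Submonoid.coe_mul, selfAdjoint.expUnitary_coe, smul_comm]
  rfl

@[simp]
lemma geodesic_zero : geodesic W X 0 = W := by simp [geodesic]

@[simp]
lemma geodesic_one : geodesic W X 1 = W * expUnitary X := by simp [geodesic]

lemma expUnitary_add_smul (a b : ℝ) :
    expUnitary ((a + b) • X) = expUnitary (a • X) * expUnitary (b • X) := by
  rw [add_smul]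
  refine Commute.expUnitary_add ?_
  exact ((Commute.refl (X : Matrix (Fin n) (Fin n) ℂ)).smul_left a).smul_right b

lemma geodesic_add (a b : ℝ) :
    geodesic W X (a + b) = geodesic W X a * expUnitary (b • X) := by
  rw [geodesic, expUnitary_add_smul, ← mul_assoc, geodesic]

lemma expUnitary_mul_expUnitary_neg : expUnitary X * expUnitary (-X) = 1 := by
  have := expUnitary_add_smul X 1 (-1)
  simpa using this.symm

lemma isGeodesic_geodesic : IsGeodesic (geodesic W X) := by
  refine ⟨W, Complex.I • (X : Matrix (Fin n) (Fin n) ℂ), ?_, coe_geodesic W X⟩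
  have : (X : Matrix (Fin n) (Fin n) ℂ).conjTranspose = X := X.2
  rw [Matrix.conjTranspose_smul, this]
  simp

lemma IsGeodesic.exists_eq_geodesic {β : ℝ → Matrix.unitaryGroup (Fin n) ℂ} (hβ : IsGeodesic β) :
    ∃ (W : Matrix.unitaryGroup (Fin n) ℂ) (X : selfAdjoint (Matrix (Fin n) (Fin n) ℂ)),
      β = geodesic W X := by
  obtain ⟨W, Z, hZ, hβ⟩ := hβ
  refine ⟨W, ⟨-Complex.I • Z, ?_⟩, ?_⟩
  · rw [selfAdjoint.mem_iff, Matrix.star_eq_conjTranspose, Matrix.conjTranspose_smul, hZ]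
    simp
  · funext s
    apply Subtype.ext
    rw [hβ, coe_geodesic, smul_smul]
    simp

lemma hasDerivAt_geodesic (s : ℝ) :
    HasDerivAt (fun r => (geodesic W X r : Matrix (Fin n) (Fin n) ℂ))
      (geodesic W X s * (Complex.I • (X : Matrix (Fin n) (Fin n) ℂ))) s := by
  simp_rw [coe_geodesic, mul_assoc]
  exact (hasDerivAt_exp_smul_const (𝕂 := ℝ) (Complex.I • (X : Matrix (Fin n) (Fin n) ℂ)) s).const_mul
    (W : Matrix (Fin n) (Fin n) ℂ)

lemma curveLength_geodesic : curveLength (geodesic W X) = ‖X‖ := by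
  have h (s : ℝ) : ‖deriv (fun r => (geodesic W X r : Matrix (Fin n) (Fin n) ℂ)) s‖ = ‖X‖ := by
    rw [(hasDerivAt_geodesic W X s).deriv, CStarRing.norm_coe_unitary_mul, norm_smul, Complex.norm_I,
      one_mul]
    rfl
  simp [curveLength, h]

lemma isPiecewiseSmooth_geodesic : IsPiecewiseSmooth (geodesic W X) := by
  -- A single smooth piece; the subdivision stays at `1` afterwards, as monotonicity is required on
  -- all of `ℕ`.
  refine ⟨1, fun i => min i 1, fun i j hij => by dsimp only; gcongr, by simp, by simp, ?_⟩
  intro i _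
  simp_rw [coe_geodesic]
  refine ContDiff.contDiffOn (contDiff_const.mul ?_)
  exact (contDiff_iff_contDiffAt.2 fun x => (NormedSpace.exp_analytic (𝕂 := ℝ)
    (𝔸 := Matrix (Fin n) (Fin n) ℂ) x).contDiffAt).comp
    (contDiff_id.smul contDiff_const)

end Geodesic

/-! ### The distance: explicit formula, symmetry, triangle inequality -/

lemma curveLength_nonneg (α : ℝ → Matrix.unitaryGroup (Fin n) ℂ) : 0 ≤ curveLength α :=
  intervalIntegral.integral_nonneg zero_le_one fun _ _ => norm_nonneg _

lemma dInf_nonneg (U V : Matrix.unitaryGroup (Fin n) ℂ) : 0 ≤ dInf U V := by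
  refine Real.sInf_nonneg ?_
  rintro _ ⟨α, -, -, -, rfl⟩
  exact curveLength_nonneg α

lemma dInf_mul_expUnitary_le (W : Matrix.unitaryGroup (Fin n) ℂ)
    (X : selfAdjoint (Matrix (Fin n) (Fin n) ℂ)) : dInf W (W * expUnitary X) ≤ ‖X‖ := by
  refine csInf_le ⟨0, ?_⟩ ⟨geodesic W X, isPiecewiseSmooth_geodesic W X, geodesic_zero W X,
    geodesic_one W X, curveLength_geodesic W X⟩
  rintro _ ⟨α, -, -, -, rfl⟩
  exact curveLength_nonneg α

lemma angle_le_dInf (U V : Matrix.unitaryGroup (Fin n) ℂ) {v : EuclideanSpace ℂ (Fin n)}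
    (hv : ‖v‖ = 1) :
    InnerProductGeometry.angle (action (U : Matrix (Fin n) (Fin n) ℂ) v)
      (action (V : Matrix (Fin n) (Fin n) ℂ) v) ≤ dInf U V := by
  -- The logarithm serves only to make the set of lengths nonempty.
  obtain ⟨X, -, rfl⟩ := exists_eq_mul_expUnitary U V
  refine le_csInf ⟨_, geodesic U X, isPiecewiseSmooth_geodesic U X, geodesic_zero U X,
    geodesic_one U X, rfl⟩ ?_
  rintro _ ⟨α, hα, h0, h1, rfl⟩
  rw [InnerProductGeometry.angle, norm_action_unitary, norm_action_unitary, hv, mul_one, div_one,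
    ← h1, ← h0]
  exact arccos_inner_le_curveLength hα hv

lemma real_inner_eq_re (x y : EuclideanSpace ℂ (Fin n)) :
    inner ℝ x y = (inner ℂ x y : ℂ).re := by
  simp [PiLp.inner_apply, Complex.inner]

lemma exists_angle_eq_norm [NeZero n] (W : Matrix.unitaryGroup (Fin n) ℂ)
    (X : selfAdjoint (Matrix (Fin n) (Fin n) ℂ)) (hX : ‖X‖ ≤ Real.pi) :
    ∃ v : EuclideanSpace ℂ (Fin n), ‖v‖ = 1 ∧
      InnerProductGeometry.angle (action (W : Matrix (Fin n) (Fin n) ℂ) v)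
        (action ((W * expUnitary X : Matrix.unitaryGroup (Fin n) ℂ) :
          Matrix (Fin n) (Fin n) ℂ) v) = ‖X‖ := by
  obtain ⟨v, θ, hv, hθ, he⟩ := exists_extremal_eigenvector X
  refine ⟨v, hv, ?_⟩
  have h1 := action_expUnitary_of_eigenvector he 1
  rw [one_smul, one_mul] at h1
  rw [InnerProductGeometry.angle, norm_action_unitary, norm_action_unitary, hv, mul_one, div_one,
    Submonoid.coe_mul, action_mul_apply, h1, map_smul, real_inner_eq_re, inner_smul_right,
    inner_self_eq_norm_sq_to_K, norm_action_unitary, hv]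
  have h2 : Complex.re (Complex.exp ((θ : ℝ) * Complex.I) * (((1 : ℝ) : ℂ)) ^ 2) = Real.cos |θ| := by
    simp [Complex.exp_ofReal_mul_I_re]
  refine (congrArg Real.arccos h2).trans ?_
  rw [hθ, Real.arccos_cos (norm_nonneg _) hX]

/-- One-parameter groups are minimal up to length `π`. -/
theorem dInf_mul_expUnitary (W : Matrix.unitaryGroup (Fin n) ℂ)
    {X : selfAdjoint (Matrix (Fin n) (Fin n) ℂ)} (hX : ‖X‖ ≤ Real.pi) :
    dInf W (W * expUnitary X) = ‖X‖ := by
  refine le_antisymm (dInf_mul_expUnitary_le W X) ?_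
  -- For `n = 0` there is no unit vector to test with.
  rcases Nat.eq_zero_or_pos n with rfl | hn
  · rw [Subsingleton.elim X 0, norm_zero]
    exact dInf_nonneg _ _
  · have : NeZero n := ⟨hn.ne'⟩
    obtain ⟨v, hv, h⟩ := exists_angle_eq_norm W X hX
    exact h ▸ angle_le_dInf _ _ hv

lemma dInf_comm (U V : Matrix.unitaryGroup (Fin n) ℂ) : dInf U V = dInf V U := by
  obtain ⟨X, hX, rfl⟩ := exists_eq_mul_expUnitary U V
  have h := dInf_mul_expUnitary (U * expUnitary X) (X := -X) (by rwa [norm_neg])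
  rw [mul_assoc, expUnitary_mul_expUnitary_neg, mul_one, norm_neg] at h
  rw [h, dInf_mul_expUnitary U hX]

/-- Choosing `v` so that its angle realises `dInf U W` reduces this to the triangle inequality for
angles; no concatenation of curves is needed. -/
theorem dInf_triangle (U V W : Matrix.unitaryGroup (Fin n) ℂ) :
    dInf U W ≤ dInf U V + dInf V W := by
  obtain ⟨X, hX, rfl⟩ := exists_eq_mul_expUnitary U W
  rw [dInf_mul_expUnitary U hX]
  rcases Nat.eq_zero_or_pos n with rfl | hn
  · rw [Subsingleton.elim X 0, norm_zero]
    exact add_nonneg (dInf_nonneg _ _) (dInf_nonneg _ _)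
  · have : NeZero n := ⟨hn.ne'⟩
    obtain ⟨v, hv, h⟩ := exists_angle_eq_norm U X hX
    rw [← h]
    exact (InnerProductGeometry.angle_le_angle_add_angle _
      (action (V : Matrix (Fin n) (Fin n) ℂ) v) _).trans
      (add_le_add (angle_le_dInf _ _ hv) (angle_le_dInf _ _ hv))

/-! ### Numerical ranges in sectors and convexity of balls -/

lemma abs_sin_mul_cos_le {θ r : ℝ} (hθ : |θ| ≤ r) (hr : r ≤ Real.pi) :
    |Real.sin θ| * Real.cos r ≤ Real.cos θ * Real.sin r := by
  have h0 := abs_nonneg θ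
  have h1 : Real.sin (|θ| - r) ≤ 0 := Real.sin_nonpos_of_nonpos_of_neg_pi_le (by linarith)
    (by linarith)
  have h2 : |Real.sin θ| = Real.sin |θ| := by
    rw [Real.abs_sin_eq_sin_abs_of_abs_le_pi (hθ.trans hr)]
  rw [Real.sin_sub, Real.cos_abs, ← h2] at h1
  linarith

/-- The hypothesis is `sin (|θ| - r) ≤ 0`, and `cos θ > 0` excludes `|θ| ≥ π / 2`. -/
lemma abs_le_of_sin_mul_cos_le {θ r : ℝ} (hθ : |θ| ≤ Real.pi) (hcos : 0 < Real.cos θ)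
    (h0 : 0 ≤ r) (hr : r < Real.pi / 2)
    (h : |Real.sin θ| * Real.cos r ≤ Real.cos θ * Real.sin r) : |θ| ≤ r := by
  have hlt : |θ| < Real.pi / 2 := by
    by_contra! hge
    have := Real.cos_nonpos_of_pi_div_two_le_of_le hge (by linarith [Real.pi_pos])
    rw [Real.cos_abs] at this
    linarith
  by_contra! hgt
  have h1 : 0 < Real.sin (|θ| - r) := Real.sin_pos_of_pos_of_lt_pi (by linarith)
    (by linarith [Real.pi_pos])
  rw [Real.sin_sub, Real.cos_abs, ← Real.abs_sin_eq_sin_abs_of_abs_le_pi hθ] at h1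
  linarith

/-- The numerical range of `e^{iX}` lies in the sector of half-angle `‖X‖ < π / 2`. -/
lemma numericalRange_expUnitary_mem_sector {X : selfAdjoint (Matrix (Fin n) (Fin n) ℂ)} {r : ℝ}
    (hX : ‖X‖ ≤ r) (hr : r < Real.pi / 2) {v : EuclideanSpace ℂ (Fin n)} (hv : ‖v‖ = 1) {z : ℂ}
    (hz : z = inner ℂ v (action (expUnitary X : Matrix (Fin n) (Fin n) ℂ) v)) :
    0 < z.re ∧ |z.im| * Real.cos r ≤ z.re * Real.sin r := by
  obtain ⟨p, θ, hp, hsum, hθ, h⟩ := exists_spectral_weights X v hv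
  have h1 := h 1
  rw [one_smul, ← hz] at h1
  have hre : z.re = ∑ j, p j * Real.cos (θ j) := by
    simp [h1, Complex.re_sum, Complex.exp_ofReal_mul_I_re]
  have him : z.im = ∑ j, p j * Real.sin (θ j) := by
    simp [h1, Complex.im_sum, Complex.exp_ofReal_mul_I_im]
  have h0 : 0 ≤ r := (norm_nonneg X).trans hX
  have hπ := Real.pi_pos
  constructor
  · have hc : 0 < Real.cos r := Real.cos_pos_of_mem_Ioo ⟨by linarith, hr⟩
    calc 0 < Real.cos r := hc
      _ = ∑ j, p j * Real.cos r := by rw [← Finset.sum_mul, hsum, one_mul]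
      _ ≤ z.re := by
        rw [hre]
        refine Finset.sum_le_sum fun j _ => mul_le_mul_of_nonneg_left ?_ (hp j)
        rw [← Real.cos_abs (θ j)]
        exact Real.cos_le_cos_of_nonneg_of_le_pi (abs_nonneg _) (by linarith) ((hθ j).trans hX)
  · have hc : 0 ≤ Real.cos r := Real.cos_nonneg_of_mem_Icc ⟨by linarith, hr.le⟩
    calc |z.im| * Real.cos r ≤ (∑ j, p j * |Real.sin (θ j)|) * Real.cos r := by
          gcongr
          rw [him]
          refine (Finset.abs_sum_le_sum_abs _ _).trans_eq (Finset.sum_congr rfl fun j _ => ?_)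
          rw [abs_mul, abs_of_nonneg (hp j)]
      _ ≤ z.re * Real.sin r := by
          rw [hre, Finset.sum_mul, Finset.sum_mul]
          refine Finset.sum_le_sum fun j _ => ?_
          rw [mul_assoc, mul_assoc]
          exact mul_le_mul_of_nonneg_left
            (abs_sin_mul_cos_le ((hθ j).trans hX) (by linarith)) (hp j)

/-- The two terms are complex conjugates, so the sum is twice a real part, positive by the sector
bound. -/
lemma inner_expUnitary_add_neg_pos {Y : selfAdjoint (Matrix (Fin n) (Fin n) ℂ)}
    (hY : ‖Y‖ < Real.pi / 2) {v : EuclideanSpace ℂ (Fin n)} (hv : ‖v‖ = 1) :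
    ∃ c : ℝ, 0 < c ∧ inner ℂ v (action (expUnitary Y : Matrix (Fin n) (Fin n) ℂ) v) +
      inner ℂ v (action (expUnitary (-Y) : Matrix (Fin n) (Fin n) ℂ) v) = c := by
  obtain ⟨p, θ, hp, hsum, hθ, h⟩ := exists_spectral_weights Y v hv
  have h1 := h 1
  have h2 := h (-1)
  rw [one_smul] at h1
  rw [neg_smul, one_smul] at h2
  have hpos := (numericalRange_expUnitary_mem_sector le_rfl hY hv rfl).1
  refine ⟨2 * (inner ℂ v (action (expUnitary Y : Matrix (Fin n) (Fin n) ℂ) v) : ℂ).re,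
    by positivity, ?_⟩
  have h3 : inner ℂ v (action (expUnitary (-Y) : Matrix (Fin n) (Fin n) ℂ) v) =
      starRingEnd ℂ (inner ℂ v (action (expUnitary Y : Matrix (Fin n) (Fin n) ℂ) v)) := by
    rw [h1, h2, map_sum]
    refine Finset.sum_congr rfl fun j _ => ?_
    rw [map_mul, Complex.conj_ofReal, ← Complex.exp_conj, map_mul, Complex.conj_ofReal,
      Complex.conj_I]
    congr 2
    push_cast
    ring
  rw [h3, Complex.add_conj]

lemma expUnitary_neg (X : selfAdjoint (Matrix (Fin n) (Fin n) ℂ)) :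
    expUnitary (-X) = star (expUnitary X) :=
  (eq_inv_of_mul_eq_one_right (expUnitary_mul_expUnitary_neg X))

lemma inner_expUnitary_mul_of_eigenvector {X : selfAdjoint (Matrix (Fin n) (Fin n) ℂ)}
    {v : EuclideanSpace ℂ (Fin n)} {θ : ℝ}
    (h : action (X : Matrix (Fin n) (Fin n) ℂ) v = (θ : ℂ) • v)
    (M : Matrix.unitaryGroup (Fin n) ℂ) :
    inner ℂ v (action ((expUnitary X * M : Matrix.unitaryGroup (Fin n) ℂ) :
      Matrix (Fin n) (Fin n) ℂ) v) =
      Complex.exp (θ * Complex.I) * inner ℂ v (action (M : Matrix (Fin n) (Fin n) ℂ) v) := by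
  have h1 := action_expUnitary_of_eigenvector h (-1)
  rw [neg_smul, one_smul, expUnitary_neg, Unitary.coe_star] at h1
  rw [Submonoid.coe_mul, action_mul_apply, ← inner_action_star, h1, inner_smul_left,
    ← Complex.exp_conj]
  simp

/-- The midpoint of a short geodesic is the unitary polar factor of the sum of its end points. -/
theorem dInf_midpoint_le (U M : Matrix.unitaryGroup (Fin n) ℂ)
    {Y : selfAdjoint (Matrix (Fin n) (Fin n) ℂ)} {r : ℝ} (hY : ‖Y‖ < Real.pi / 2)
    (hr : r < Real.pi / 2) (h0 : dInf U (M * expUnitary (-Y)) ≤ r)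
    (h1 : dInf U (M * expUnitary Y) ≤ r) : dInf U M ≤ r := by
  have hr0 : 0 ≤ r := (dInf_nonneg _ _).trans h0
  obtain ⟨X, hX, rfl⟩ := exists_eq_mul_expUnitary U M
  obtain ⟨X₀, hX₀, e0⟩ := exists_eq_mul_expUnitary U (U * expUnitary X * expUnitary (-Y))
  obtain ⟨X₁, hX₁, e1⟩ := exists_eq_mul_expUnitary U (U * expUnitary X * expUnitary Y)
  rw [e0, dInf_mul_expUnitary U hX₀] at h0
  rw [e1, dInf_mul_expUnitary U hX₁] at h1
  rw [dInf_mul_expUnitary U hX]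
  rw [mul_assoc, mul_right_inj] at e0 e1
  rcases Nat.eq_zero_or_pos n with rfl | hn
  · rw [Subsingleton.elim X 0, norm_zero]
    exact hr0
  have : NeZero n := ⟨hn.ne'⟩
  obtain ⟨v, θ, hv, hθ, he⟩ := exists_extremal_eigenvector X
  obtain ⟨c, hc, hsum⟩ := inner_expUnitary_add_neg_pos hY hv
  obtain ⟨a0, b0⟩ := numericalRange_expUnitary_mem_sector h0 hr hv rfl
  obtain ⟨a1, b1⟩ := numericalRange_expUnitary_mem_sector h1 hr hv rfl
  rw [← e0, inner_expUnitary_mul_of_eigenvector he] at a0 b0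
  rw [← e1, inner_expUnitary_mul_of_eigenvector he] at a1 b1
  set z0 := Complex.exp (θ * Complex.I) *
    inner ℂ v (action (expUnitary (-Y) : Matrix (Fin n) (Fin n) ℂ) v)
  set z1 := Complex.exp (θ * Complex.I) *
    inner ℂ v (action (expUnitary Y : Matrix (Fin n) (Fin n) ℂ) v)
  -- Both `z0` and `z1` lie in the sector of half-angle `r`, hence so does their sum, whose argument
  -- is that of `e^{iθ}`.
  have hz : z1 + z0 = Complex.exp (θ * Complex.I) * c := by rw [← hsum, mul_add]
  have hre : z1.re + z0.re = Real.cos θ * c := by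
    rw [← Complex.add_re, hz, Complex.re_mul_ofReal, Complex.exp_ofReal_mul_I_re]
  have him : z1.im + z0.im = Real.sin θ * c := by
    rw [← Complex.add_im, hz, Complex.im_mul_ofReal, Complex.exp_ofReal_mul_I_im]
  rw [← hθ] at hX ⊢
  refine abs_le_of_sin_mul_cos_le hX ?_ hr0 hr ?_
  · exact pos_of_mul_pos_left (by linarith) hc.le
  · refine le_of_mul_le_mul_right ?_ hc
    have hcos : 0 ≤ Real.cos r := Real.cos_nonneg_of_mem_Icc
      ⟨by linarith [Real.pi_pos], hr.le⟩
    calc |Real.sin θ| * Real.cos r * c = |z1.im + z0.im| * Real.cos r := by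
          rw [him, abs_mul, abs_of_pos hc]; ring
      _ ≤ (|z1.im| + |z0.im|) * Real.cos r := by gcongr; exact abs_add_le _ _
      _ ≤ (z1.re + z0.re) * Real.sin r := by linarith
      _ = _ := by rw [hre]; ring

/-- The nearest points of `T` on either side of `s` would have a nearer midpoint unless one of them
is `s`. -/
lemma Icc_subset_of_isClosed_of_midpoint {T : Set ℝ} (hT : IsClosed T) (h0 : (0 : ℝ) ∈ T)
    (h1 : (1 : ℝ) ∈ T)
    (hmid : ∀ a ∈ Icc (0 : ℝ) 1, ∀ b ∈ Icc (0 : ℝ) 1, a ∈ T → b ∈ T → (a + b) / 2 ∈ T) :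
    Icc 0 1 ⊆ T := by
  intro s hs
  obtain ⟨a, ⟨haT, ha⟩, ha'⟩ :=
    (isCompact_Icc.inter_left hT : IsCompact (T ∩ Icc 0 s)).exists_isGreatest ⟨0, h0, le_rfl, hs.1⟩
  obtain ⟨b, ⟨hbT, hb⟩, hb'⟩ :=
    (isCompact_Icc.inter_left hT : IsCompact (T ∩ Icc s 1)).exists_isLeast ⟨1, h1, hs.2, le_rfl⟩
  have hm := hmid a ⟨ha.1, ha.2.trans hs.2⟩ b ⟨hs.1.trans hb.1, hb.2⟩ haT hbT
  have hab := ha.2.trans hb.1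
  rcases le_total ((a + b) / 2) s with h | h
  · have := ha' ⟨hm, by linarith [ha.1], h⟩
    have : a = s := by linarith [hb.1, ha.2]
    exact this ▸ haT
  · have := hb' ⟨hm, h, by linarith [hb.2]⟩
    have : b = s := by linarith [hb.1, ha.2]
    exact this ▸ hbT

lemma continuous_dInf_geodesic (U W : Matrix.unitaryGroup (Fin n) ℂ)
    (X : selfAdjoint (Matrix (Fin n) (Fin n) ℂ)) :
    Continuous fun s => dInf U (geodesic W X s) := by
  refine (LipschitzWith.of_le_add_mul ‖X‖₊ fun s s' => ?_).continuous
  refine (dInf_triangle U (geodesic W X s') _).trans ?_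
  have h : geodesic W X s = geodesic W X s' * expUnitary ((s - s') • X) := by
    rw [← geodesic_add]
    congr 1
    ring
  have h2 := dInf_mul_expUnitary_le (geodesic W X s') ((s - s') • X)
  rw [← h, norm_smul, mul_comm, ← dist_eq_norm] at h2
  simpa using h2

/-- Balls of radius less than `π / 2` are convex along short geodesics. -/
theorem dInf_geodesic_le (U W : Matrix.unitaryGroup (Fin n) ℂ)
    {X : selfAdjoint (Matrix (Fin n) (Fin n) ℂ)} {r : ℝ} (hX : ‖X‖ < Real.pi)
    (hr : r < Real.pi / 2) (h0 : dInf U W ≤ r) (h1 : dInf U (W * expUnitary X) ≤ r) {s : ℝ}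
    (hs : s ∈ Icc (0 : ℝ) 1) : dInf U (geodesic W X s) ≤ r := by
  refine Icc_subset_of_isClosed_of_midpoint (T := {s | dInf U (geodesic W X s) ≤ r})
    (isClosed_le (continuous_dInf_geodesic U W X) continuous_const) (by simpa using h0)
    (by simpa using h1) (fun a ha b hb haT hbT => ?_) hs
  -- `a` and `b` are reached from their midpoint by `∓(b - a) / 2`, of modulus at most `1 / 2`; this
  -- turns `‖X‖ < π` into `‖Y‖ < π / 2`.
  refine dInf_midpoint_le U _ (Y := ((b - a) / 2) • X) ?_ hr ?_ ?_
  · rw [norm_smul, Real.norm_eq_abs]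
    have : |(b - a) / 2| ≤ 1 / 2 := abs_le.2 ⟨by linarith [ha.2, hb.1], by linarith [ha.1, hb.2]⟩
    nlinarith [norm_nonneg X]
  · rw [← neg_smul, ← geodesic_add]
    rw [show (a + b) / 2 + -((b - a) / 2) = a by ring]
    exact haT
  · rw [← geodesic_add]
    rw [show (a + b) / 2 + (b - a) / 2 = b by ring]
    exact hbT

/-! ### Uniqueness of minimal geodesics and the conclusion -/

lemma eq_of_expUnitary_eq {X Y : selfAdjoint (Matrix (Fin n) (Fin n) ℂ)} (hX : ‖X‖ < Real.pi)
    (hY : ‖Y‖ < Real.pi) (h : expUnitary X = expUnitary Y) : X = Y := by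
  rw [← argSelfAdjoint_expUnitary hX, h, argSelfAdjoint_expUnitary hY]

/-- Points at distance less than `π` are joined by exactly one minimal geodesic. -/
theorem isMinimalGeodesic_iff {W : Matrix.unitaryGroup (Fin n) ℂ}
    {X : selfAdjoint (Matrix (Fin n) (Fin n) ℂ)} (hX : ‖X‖ < Real.pi)
    {β : ℝ → Matrix.unitaryGroup (Fin n) ℂ} :
    IsMinimalGeodesic W (W * expUnitary X) β ↔ β = geodesic W X := by
  constructor
  · rintro ⟨hβ, h0, h1, hlen⟩
    obtain ⟨W', Y, rfl⟩ := hβ.exists_eq_geodesic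
    rw [geodesic_zero] at h0
    subst h0
    rw [geodesic_one, mul_right_inj] at h1
    rw [curveLength_geodesic, dInf_mul_expUnitary _ hX.le] at hlen
    rw [eq_of_expUnitary_eq (hlen.trans_lt hX) hX h1]
  · rintro rfl
    exact ⟨isGeodesic_geodesic W X, geodesic_zero W X, geodesic_one W X,
      by rw [curveLength_geodesic, dInf_mul_expUnitary W hX.le]⟩

/-- The two bounds add up to `dInf U V`, so the triangle inequality forces both to be equalities. -/
lemma mem_intermediatePoints_iff {t : ℝ} {U V W : Matrix.unitaryGroup (Fin n) ℂ} :
    W ∈ intermediatePoints t U V ↔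
      dInf U W ≤ t * dInf U V ∧ dInf V W ≤ (1 - t) * dInf U V := by
  rw [dInf_comm V W]
  refine ⟨fun h => ⟨h.1.le, h.2.le⟩, fun ⟨h1, h2⟩ => ?_⟩
  have := dInf_triangle U W V
  exact ⟨by linarith, by linarith⟩

theorem geodesicallyConvex_intermediatePoints {U V : Matrix.unitaryGroup (Fin n) ℂ}
    (hUV : dInf U V < Real.pi / 2) {t : ℝ} (ht : t ∈ Ioo (0 : ℝ) 1) :
    GeodesicallyConvex (intermediatePoints t U V) := by
  intro W₀ h₀ W₁ h₁
  rw [mem_intermediatePoints_iff] at h₀ h₁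
  have hd := dInf_nonneg U V
  have hπ := Real.pi_pos
  have hU : t * dInf U V < Real.pi / 2 := by nlinarith [ht.2]
  have hV : (1 - t) * dInf U V < Real.pi / 2 := by nlinarith [ht.1]
  obtain ⟨X, hXπ, rfl⟩ := exists_eq_mul_expUnitary W₀ W₁
  -- Through `U`, the points are at distance at most `2 * t * dInf U V < π`.
  have hX : ‖X‖ < Real.pi := by
    rw [← dInf_mul_expUnitary W₀ hXπ]
    have := dInf_triangle W₀ U (W₀ * selfAdjoint.expUnitary X)
    rw [dInf_comm W₀ U] at this
    linarith [h₀.1, h₁.1]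
  refine ⟨⟨geodesic W₀ X, (isMinimalGeodesic_iff hX).2 rfl,
    fun β hβ => (isMinimalGeodesic_iff hX).1 hβ⟩, fun β hβ s hs => ?_⟩
  rw [(isMinimalGeodesic_iff hX).1 hβ, mem_intermediatePoints_iff]
  exact ⟨dInf_geodesic_le U W₀ hX hU h₀.1 h₁.1 hs, dInf_geodesic_le V W₀ hX hV h₀.2 h₁.2 hs⟩

end UnitaryFinsler

theorem mainTheorem8 (n : ℕ) (U V : Matrix.unitaryGroup (Fin n) ℂ)
    (hUV : UnitaryFinsler.dInf U V < Real.pi / 2) (t : ℝ) (ht : t ∈ Set.Ioo (0 : ℝ) 1) :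
    UnitaryFinsler.GeodesicallyConvex (UnitaryFinsler.intermediatePoints t U V) :=
  UnitaryFinsler.geodesicallyConvex_intermediatePoints hUV ht
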